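/- Write $\omega$ for the set of natural numbers, and for $A,B\subseteq\omega$ say that $A$ computes $B$ if $B$ is Turing reducible to $A$. Consider the following principles, each given by a class of instances and, for each instance, a class of solutions, which are subsets of $\omega$. - $\mathsf{COH}$: the instances are the sequences $\vec R=\langle R_i : i\in\omega\rangle$ of subsets of $\omega$ (each identified with the set $\{\langle i,x\rangle : x\in R_i\}$). The solutions to $\vec R$ are the $\vec R$-cohesive sets, i.e. the infinite sets $S\subseteq\omega$ such that for each $i$ at least one of $S\cap R_i$ and $S\cap\overline{R_i}$ is finite. - $\mathsf{D}^2_m$, for $m\in\omega$: an instance is a set $X\subseteq\omega$ together with a partition $A_0,\ldots,A_{m-1}$ of $\omega$ (parts may be empty) such that each $A_j$ is $\Delta^0_2$ in $X$; a set computes this instance if it computes $X$. The solutions are the infinite subsets of the $A_j$, $j<m$. - $\forall m\,\mathsf{D}^2_m$: an instance is a number $m\in\omega$ together with an instance of $\mathsf{D}^2_m$, and it has the same solutions (and is computed by the same sets) as that instance of $\mathsf{D}^2_m$. A principle $\mathsf{P}$ is strongly reducible to a principle $\mathsf{Q}$ if every instance $A$ of $\mathsf{P}$ computes an instance $B$ of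 $\mathsf{Q}$ such that every solution to $B$ computes a solution to $A$. Then for each $m\in\omega$, $\mathsf{COH}$ is not strongly reducible to $\mathsf{D}^2_m$. In fact, $\mathsf{COH}$ is not strongly reducible to the principle $\forall m\,\mathsf{D}^2_m$. -/

import Mathlib

namespace CohesiveAvoidance

/-- The characteristic function of a set of natural numbers. -/
noncomputable def charFn (A : Set ℕ) : ℕ → ℕ := A.indicator 1

/-- The set `A` computes the set `B`, that is, `B` is Turing reducible to `A`. -/
def Computes (A B : Set ℕ) : Prop :=
  TuringReducible (charFn B : ℕ →. ℕ) (charFn A : ℕ →. ℕ)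

/-- `A` is `Σ⁰₂` in `X`: it is defined by a formula `∃ a, ∀ b, P n a b` whose matrix `P` is
computable in `X`. -/
def IsSigma02In (X A : Set ℕ) : Prop :=
  ∃ P : Set ℕ, Computes X P ∧
    ∀ n, n ∈ A ↔ ∃ a, ∀ b, Nat.pair n (Nat.pair a b) ∈ P

/-- `A` is `Π⁰₂` in `X`: it is defined by a formula `∀ a, ∃ b, P n a b` whose matrix `P` is
computable in `X`. -/
def IsPi02In (X A : Set ℕ) : Prop :=
  ∃ P : Set ℕ, Computes X P ∧
    ∀ n, n ∈ A ↔ ∀ a, ∃ b, Nat.pair n (Nat.pair a b) ∈ P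

/-- `A` is `Δ⁰₂` in `X`: it has both a `Σ⁰₂` and a `Π⁰₂` definition in `X`. -/
def IsDelta02In (X A : Set ℕ) : Prop :=
  IsSigma02In X A ∧ IsPi02In X A

/-- The computability-theoretic content of a `Π¹₂` principle: its instances, the set of natural
numbers that presents an instance (up to finite information, such as numbers and indices of
formulas, which every set computes), and the solutions of each instance. -/
structure Principle where
  /-- The instances. -/
  Inst : Type
  /-- The set of natural numbers that presents an instance; to compute an instance is to compute
  this set. -/
  data : Inst → Set ℕ
  /-- `IsSol B S` says that `S` is a solution to the instance `B`. -/
  IsSol : Inst → Set ℕ → Prop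

/-- `P` is strongly reducible to `Q`: every instance `A` of `P` computes an instance `B` of `Q`
such that every solution to `B` computes a solution to `A`. -/
def StronglyReducible (P Q : Principle) : Prop :=
  ∀ A : P.Inst, ∃ B : Q.Inst, Computes (P.data A) (Q.data B) ∧
    ∀ S, Q.IsSol B S → ∃ T, P.IsSol A T ∧ Computes S T

/-- `S` is cohesive for the sequence `R`. -/
def IsCohesive (R : ℕ → Set ℕ) (S : Set ℕ) : Prop :=
  S.Infinite ∧ ∀ i, (S ∩ R i).Finite ∨ (S ∩ (R i)ᶜ).Finite

/-- The join `{⟨i, x⟩ : x ∈ R i}`, which codes the sequence `R` as a single set. -/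
def seqJoin (R : ℕ → Set ℕ) : Set ℕ := {p | p.unpair.2 ∈ R p.unpair.1}

/-- `COH`: every sequence of sets has a cohesive set. -/
def COH : Principle where
  Inst := ℕ → Set ℕ
  data := seqJoin
  IsSol := IsCohesive

/-- An instance of `D²_m`: a set `X` and a partition `A 0, …, A (m - 1)` of `ℕ` (some of the
parts may be empty) that is `Δ⁰₂` in `X`. -/
structure DInstance (m : ℕ) where
  X : Set ℕ
  A : Fin m → Set ℕ
  disjoint : ∀ i j, i ≠ j → Disjoint (A i) (A j)
  cover : (⋃ j, A j) = Set.univ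
  delta : ∀ j, IsDelta02In X (A j)

/-- A solution to an instance of `D²_m`: an infinite subset of some part of the partition. -/
def DInstance.IsSol {m : ℕ} (B : DInstance m) (S : Set ℕ) : Prop :=
  S.Infinite ∧ ∃ j, S ⊆ B.A j

/-- `D²_m`: whenever `A 0, …, A (m - 1)` is a partition of `ℕ` that is `Δ⁰₂` in a set `X`, some
`A j` has an infinite subset. An instance is presented by the set `X`. -/
def D2 (m : ℕ) : Principle where
  Inst := DInstance m
  data := DInstance.X
  IsSol := DInstance.IsSol

/-- `∀ m, D²_m`: an instance is a number `m` together with an instance of `D²_m`. -/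
def AllD2 : Principle where
  Inst := Σ m : ℕ, DInstance m
  data := fun B => B.2.X
  IsSol := fun B => B.2.IsSol

end CohesiveAvoidance

namespace CohesiveAvoidance

open Set Topology Filter

/-! The instance of `COH` is the sequence of columns of a generic `g`. A strong reduction would give
a partition that is `Σ⁰₂` in `g`, so it suffices to find, for every such partition, an infinite
subset `H` of some part from which no operator enumerates a cohesive set. The operator sees only
`H`, not `g`, so reservoirs for `H` may be arbitrary infinite sets. With `m` parts, consider the
first `m` columns: they give each number one of `2 ^ m` colors, and a cohesive set has a single
color from some point on. As `m < 2 ^ m`, some color `l` differs from all `m` colors guessed, one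
per part. Either some infinite reservoir stops one operator from giving large elements, or by
compactness (`exists_bound_of_infinite_subsets`) a finite stretch of the reservoir makes some
operator give one however it is split. In the second case, color all possible witnesses `l` first
and settle the partition afterwards (`State.Valid.exists_extends_defeats`). The Baire property makes
the partitions open off a meager set, and one generic `g` treats them all (`exists_generic`). -/

/-! ### Oracle computations and the use principle -/

/-- Codes for partial functions computed relative to an oracle. -/
inductive OracleCode : Type
  | zero : OracleCode
  | succ : OracleCode
  | left : OracleCode
  | right : OracleCode
  | oracle : OracleCode
  | pair : OracleCode → OracleCode → OracleCode
  | comp : OracleCode → OracleCode → OracleCode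
  | prec : OracleCode → OracleCode → OracleCode
  | rfind : OracleCode → OracleCode
  deriving Countable

namespace OracleCode

instance : Nonempty OracleCode := ⟨zero⟩

/-- The partial function computed by a code relative to the oracle `g`. -/
def eval (g : ℕ → ℕ) : OracleCode → ℕ →. ℕ
  | zero => fun _ => Part.some 0
  | succ => fun n => Part.some (n + 1)
  | left => fun n => Part.some n.unpair.1
  | right => fun n => Part.some n.unpair.2
  | oracle => fun n => Part.some (g n)
  | pair c d => fun n => Nat.pair <$> eval g c n <*> eval g d n
  | comp c d => fun n => eval g d n >>= eval g c
  | prec c d => fun p =>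
      p.unpair.2.rec (eval g c p.unpair.1) fun y IH =>
        IH >>= fun i => eval g d (Nat.pair p.unpair.1 (Nat.pair y i))
  | rfind c => fun a => Nat.rfind fun n => (fun m => m = 0) <$> eval g c (Nat.pair a n)

theorem exists_eval_eq {g : ℕ → ℕ} {f : ℕ →. ℕ} (hf : Nat.RecursiveIn {(g : ℕ →. ℕ)} f) :
    ∃ c : OracleCode, eval g c = f := by
  induction hf with
  | zero => exact ⟨zero, rfl⟩
  | succ => exact ⟨succ, rfl⟩
  | left => exact ⟨left, rfl⟩
  | right => exact ⟨right, rfl⟩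
  | oracle h hh => rw [mem_singleton_iff.1 hh]; exact ⟨oracle, rfl⟩
  | pair _ _ ihf ihh =>
    obtain ⟨c, rfl⟩ := ihf
    obtain ⟨d, rfl⟩ := ihh
    exact ⟨pair c d, rfl⟩
  | comp _ _ ihf ihh =>
    obtain ⟨c, rfl⟩ := ihf
    obtain ⟨d, rfl⟩ := ihh
    exact ⟨comp c d, rfl⟩
  | prec _ _ ihf ihh =>
    obtain ⟨c, rfl⟩ := ihf
    obtain ⟨d, rfl⟩ := ihh
    exact ⟨prec c d, rfl⟩
  | rfind _ ihf =>
    obtain ⟨c, rfl⟩ := ihf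
    exact ⟨rfind c, rfl⟩

/-- The use principle: a convergent computation depends on finitely much of the oracle. -/
theorem eventually_mem_eval (g : ℕ → ℕ) (c : OracleCode) {n v : ℕ} (h : v ∈ eval g c n) :
    ∀ᶠ g' in 𝓝 g, v ∈ eval g' c n := by
  induction c generalizing n v with
  | zero | succ | left | right => exact .of_forall fun _ => h
  | oracle =>
    have hc : ∀ᶠ g' : ℕ → ℕ in 𝓝 g, g' n = g n :=
      (continuous_apply n).continuousAt.eventually (isOpen_discrete {g n} |>.mem_nhds rfl)
    filter_upwards [hc] with g' hg'
    simpa [eval, hg'] using h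
  | pair c d ihc ihd =>
    simp only [eval, Seq.seq, Part.map_eq_map, Part.mem_bind_iff, Part.mem_map_iff] at h
    obtain ⟨_, ⟨a, ha, rfl⟩, b, hb, rfl⟩ := h
    filter_upwards [ihc ha, ihd hb] with g' h1 h2
    simp only [eval, Seq.seq, Part.map_eq_map, Part.mem_bind_iff, Part.mem_map_iff]
    exact ⟨_, ⟨a, h1, rfl⟩, b, h2, rfl⟩
  | comp c d ihc ihd =>
    obtain ⟨a, ha, hb⟩ := Part.mem_bind_iff.1 h
    filter_upwards [ihd ha, ihc hb] with g' h1 h2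
    exact Part.mem_bind_iff.2 ⟨a, h1, h2⟩
  | prec c d ihc ihd =>
    simp only [eval] at h ⊢
    generalize n.unpair.2 = k at h ⊢
    induction k generalizing v with
    | zero => exact ihc h
    | succ k ihk =>
      obtain ⟨a, ha, hb⟩ := Part.mem_bind_iff.1 h
      filter_upwards [ihk ha, ihd hb] with g' h1 h2
      exact Part.mem_bind_iff.2 ⟨a, h1, h2⟩
  | rfind c ih =>
    have key : ∀ g' : ℕ → ℕ, v ∈ eval g' (rfind c) n ↔
        (∃ a ∈ eval g' c (Nat.pair n v), decide (a = 0) = true) ∧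
          ∀ {k}, k < v → ∃ a ∈ eval g' c (Nat.pair n k), decide (a = 0) = false := fun g' =>
      Nat.mem_rfind.trans (by simp only [Part.map_eq_map, Part.mem_map_iff])
    simp only [key] at h ⊢
    obtain ⟨⟨a, ha, ha'⟩, hlt⟩ := h
    have : ∀ᶠ g' in 𝓝 g, ∀ k ∈ Iio v, ∃ a ∈ eval g' c (Nat.pair n k), decide (a = 0) = false := by
      refine (eventually_all_finite (finite_Iio v)).2 fun k hk => ?_
      obtain ⟨b, hb, hb'⟩ := hlt hk
      filter_upwards [ih hb] with g' h1
      exact ⟨b, h1, hb'⟩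
    filter_upwards [this, ih ha] with g' h1 h2
    exact ⟨⟨a, h2, ha'⟩, fun {k} hk => h1 k hk⟩

end OracleCode

/-- An operator on sets of natural numbers has finite use if every positive answer depends only on
a finite part of the argument. -/
def FiniteUse (Ψ : Set ℕ → Set ℕ) : Prop :=
  ∀ H x, x ∈ Ψ H → ∃ u, ∀ H' : Set ℕ, (∀ y < u, y ∈ H' ↔ y ∈ H) → x ∈ Ψ H'

/-- Let `Ψ e A` collect the inputs on which the `e`-th code outputs `1`. Divergence counts as a
negative answer, so only positive answers have a finite use. -/
theorem exists_finiteUse_operators :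
    ∃ Ψ : ℕ → Set ℕ → Set ℕ, (∀ e, FiniteUse (Ψ e)) ∧
      ∀ A B, Computes A B → ∃ e, B = Ψ e A := by
  obtain ⟨code, hcode⟩ := exists_surjective_nat OracleCode
  refine ⟨fun e A => {x | 1 ∈ (code e).eval (charFn A) x}, fun e H x hx => ?_, fun A B h => ?_⟩
  · obtain ⟨s, hs, hxs, hsub⟩ := (PiNat.isTopologicalBasis_cylinders _).mem_nhds_iff.1
      ((code e).eventually_mem_eval _ hx)
    obtain ⟨z, u, rfl⟩ := hs
    refine ⟨u, fun H' hH' => hsub ?_⟩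
    intro y hy
    rw [← hxs y hy]
    classical
    simp only [charFn, indicator_apply, hH' y hy]
  · obtain ⟨c, hc⟩ := OracleCode.exists_eval_eq (RecursiveIn.iff_nat.1 h)
    obtain ⟨e, rfl⟩ := hcode c
    refine ⟨e, ?_⟩
    ext x
    rw [mem_ofPred, hc]
    classical
    simp [charFn, indicator_apply]

/-! ### Cylinders and a compactness principle -/

/-- The basic open set of all extensions of the first `p.2` bits of `p.1`. -/
def cyl (p : (ℕ → Bool) × ℕ) : Set (ℕ → Bool) :=
  PiNat.cylinder (E := fun _ => Bool) p.1 p.2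

theorem mem_cyl_iff {p : (ℕ → Bool) × ℕ} {g : ℕ → Bool} : g ∈ cyl p ↔ ∀ y < p.2, g y = p.1 y :=
  Iff.rfl

theorem self_mem_cyl (p : (ℕ → Bool) × ℕ) : p.1 ∈ cyl p := fun _ _ => rfl

theorem isOpen_cyl (p : (ℕ → Bool) × ℕ) : IsOpen (cyl p) :=
  PiNat.isOpen_cylinder (fun _ => Bool) p.1 p.2

theorem isClosed_cyl (p : (ℕ → Bool) × ℕ) : IsClosed (cyl p) := by
  have : cyl p = ⋂ y : ℕ, ⋂ _ : y < p.2, {g | g y = p.1 y} := by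
    ext g
    simp [mem_cyl_iff]
  rw [this]
  exact isClosed_iInter fun y => isClosed_iInter fun _ =>
    isClosed_eq (continuous_apply y) continuous_const

theorem exists_cyl_subset {p : (ℕ → Bool) × ℕ} {V : Set (ℕ → Bool)} (hV : IsOpen V)
    (h : (cyl p ∩ V).Nonempty) : ∃ q, cyl q ⊆ cyl p ∧ cyl q ⊆ V := by
  obtain ⟨g, hg⟩ := h
  obtain ⟨s, ⟨z, u, rfl⟩, -, hsub⟩ := (PiNat.isTopologicalBasis_cylinders
    (fun _ => Bool)).exists_subset_of_mem_open hg ((isOpen_cyl p).inter hV)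
  exact ⟨(z, u), hsub.trans inter_subset_left, hsub.trans inter_subset_right⟩

/-- Density lets a cylinder shrink into some `U x j`; finitely many `x` are handled one after
another. -/
theorem exists_cyl_decide {m : ℕ} {U : ℕ → Fin m → Set (ℕ → Bool)} (hU : ∀ x j, IsOpen (U x j))
    (J : Finset (Fin m)) (p : (ℕ → Bool) × ℕ) (T : Finset ℕ)
    (hT : ∀ x ∈ T, cyl p ⊆ closure (⋃ j ∈ J, U x j)) :
    ∃ q, cyl q ⊆ cyl p ∧ ∀ x ∈ T, ∃ j ∈ J, cyl q ⊆ U x j := by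
  induction T using Finset.induction_on with
  | empty => exact ⟨p, Subset.rfl, by simp⟩
  | insert a T _ ih =>
    obtain ⟨q, hqp, hq⟩ := ih fun x hx => hT x (Finset.mem_insert_of_mem hx)
    have hmem := hT a (Finset.mem_insert_self a T) (hqp (self_mem_cyl q))
    obtain ⟨g, hg, hgU⟩ := mem_closure_iff.1 hmem _ (isOpen_cyl q) (self_mem_cyl q)
    obtain ⟨j, hj, hgj⟩ := mem_iUnion₂.1 hgU
    obtain ⟨r, hrq, hrU⟩ := exists_cyl_subset (hU a j) ⟨g, hg, hgj⟩
    refine ⟨r, hrq.trans hqp, fun x hx => ?_⟩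
    obtain rfl | hx := Finset.mem_insert.1 hx
    · exact ⟨j, hj, hrU⟩
    · obtain ⟨i, hi, hqi⟩ := hq x hx
      exact ⟨i, hi, hrq.trans hqi⟩

/-- If every infinite subset of `X` contains, for every `j ∈ J`, a finite set with property `W j`,
then a finite part of `X` suffices to find such a set inside some cell of any partition of `X` into
cells indexed by `J`. -/
theorem exists_bound_of_infinite_subsets {m : ℕ} {X : Set ℕ} (hX : X.Infinite)
    (J : Finset (Fin m)) (W : Fin m → Finset ℕ → Prop)
    (hW : ∀ j ∈ J, ∀ Y ⊆ X, Y.Infinite → ∃ E : Finset ℕ, ↑E ⊆ Y ∧ W j E) :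
    ∃ M, ∀ f : ℕ → Fin m, (∀ x ∈ X, x < M → f x ∈ J) →
      ∃ j ∈ J, ∃ E : Finset ℕ, (∀ x ∈ E, x ∈ X ∧ x < M ∧ f x = j) ∧ W j E := by
  by_contra! hcon
  choose f hfJ hf using hcon
  -- Take the limit of the counterexamples `f M` along a nonprincipal ultrafilter; one of its cells
  -- is infinite by pigeonhole.
  have hlim : ∀ x, ∃ j, ∀ᶠ M in (hyperfilter ℕ : Filter ℕ), f M x = j := fun x => by
    obtain ⟨j, hj⟩ := ((hyperfilter ℕ).map fun M => f M x).eq_pure_of_finite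
    refine ⟨j, ?_⟩
    have : {j} ∈ (hyperfilter ℕ).map fun M => f M x := by rw [hj]; exact mem_singleton j
    exact this
  choose h hh using hlim
  have hgt : ∀ x, ∀ᶠ M in (hyperfilter ℕ : Filter ℕ), x < M := fun x =>
    (hyperfilter_le_cofinite.trans Nat.cofinite_eq_atTop.le) (eventually_gt_atTop x)
  have hJ : ∀ x ∈ X, h x ∈ J := fun x hx => by
    obtain ⟨M, h1, h2⟩ := ((hh x).and (hgt x)).exists
    exact h1 ▸ hfJ M x hx h2
  obtain ⟨j, hj, hinf⟩ : ∃ j ∈ J, {x ∈ X | h x = j}.Infinite := by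
    by_contra! hfin
    refine hX ((J.finite_toSet.biUnion hfin).subset ?_)
    exact fun x hx => mem_iUnion₂.2 ⟨h x, hJ x hx, hx, rfl⟩
  obtain ⟨E, hEY, hWE⟩ := hW j hj _ (sep_subset _ _) hinf
  have hev : ∀ᶠ M in (hyperfilter ℕ : Filter ℕ), ∀ x ∈ (E : Set ℕ), f M x = h x ∧ x < M :=
    (eventually_all_finite E.finite_toSet).2 fun x _ => (hh x).and (hgt x)
  obtain ⟨M, hM⟩ := hev.exists
  exact hf M j hj E (fun x hx => ⟨(hEY hx).1, (hM x hx).2, (hM x hx).1.trans (hEY hx).2⟩) hWE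

/-! ### Extending the state of a single partition -/

/-- A state in the construction of homogeneous subsets of a partition into `m` parts: the elements
`F j` already put into the `j`-th subset, the reservoir `X` of elements that may be added later,
and the set `J` of parts that are still allowed to meet the reservoir. -/
structure State (m : ℕ) where
  F : Fin m → Set ℕ
  X : Set ℕ
  J : Finset (Fin m)

/-- The later states. -/
structure State.Extends {m : ℕ} (s' s : State m) : Prop where
  subset_F : ∀ j, s.F j ⊆ s'.F j
  F_subset : ∀ j, s'.F j ⊆ s.F j ∪ s.X
  X_subset : s'.X ⊆ s.X
  J_subset : s'.J ⊆ s.J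

theorem State.Extends.refl {m : ℕ} (s : State m) : s.Extends s :=
  ⟨fun _ => Subset.rfl, fun _ => subset_union_left, Subset.rfl, Finset.Subset.refl _⟩

theorem State.Extends.trans {m : ℕ} {r s t : State m} (h : t.Extends s) (h' : s.Extends r) :
    t.Extends r where
  subset_F j := (h'.subset_F j).trans (h.subset_F j)
  F_subset j := (h.F_subset j).trans
    (union_subset (h'.F_subset j) (h'.X_subset.trans subset_union_right))
  X_subset := h.X_subset.trans h'.X_subset
  J_subset := h.J_subset.trans h'.J_subset

/-- The cylinder `p` forces that the state `s` is correct about the partition `U`. -/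
structure State.Valid {m : ℕ} (U : ℕ → Fin m → Set (ℕ → Bool)) (p : (ℕ → Bool) × ℕ)
    (s : State m) : Prop where
  F_forced : ∀ j, ∀ x ∈ s.F j, cyl p ⊆ U x j
  X_infinite : s.X.Infinite
  X_forced : ∀ x ∈ s.X, cyl p ⊆ closure (⋃ j ∈ s.J, U x j)

theorem State.Valid.mono {m : ℕ} {U : ℕ → Fin m → Set (ℕ → Bool)} {p q : (ℕ → Bool) × ℕ}
    {s : State m} (h : s.Valid U p) (hqp : cyl q ⊆ cyl p) : s.Valid U q where
  F_forced j x hx := hqp.trans (h.F_forced j x hx)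
  X_infinite := h.X_infinite
  X_forced x hx := hqp.trans (h.X_forced x hx)

theorem infinite_inter_Ici {X : Set ℕ} (hX : X.Infinite) (b : ℕ) : (X ∩ Ici b).Infinite := by
  have := hX.sdiff (finite_Iio b)
  rwa [sdiff_eq, compl_Iio] at this

/-- Every part either receives another element or is excluded from the reservoir. -/
theorem State.Valid.exists_extends_large {m : ℕ} {U : ℕ → Fin m → Set (ℕ → Bool)}
    (hU : ∀ x j, IsOpen (U x j)) {p : (ℕ → Bool) × ℕ} {s : State m} (hs : s.Valid U p)
    (j : Fin m) (b : ℕ) :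
    ∃ (q : (ℕ → Bool) × ℕ) (s' : State m), cyl q ⊆ cyl p ∧ s'.Extends s ∧ s'.Valid U q ∧
      (j ∈ s'.J → ∃ x ∈ s'.F j, b ≤ x) := by
  by_cases h : ∃ x ∈ s.X, b ≤ x ∧ (cyl p ∩ U x j).Nonempty
  · obtain ⟨x, hx, hbx, hne⟩ := h
    obtain ⟨q, hqp, hqU⟩ := exists_cyl_subset (hU x j) hne
    refine ⟨q, ⟨Function.update s.F j (insert x (s.F j)), s.X, s.J⟩, hqp, ?_, ?_, fun _ => ?_⟩
    · refine ⟨fun i => ?_, fun i => ?_, Subset.rfl, Finset.Subset.refl _⟩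
      · obtain rfl | hij := eq_or_ne i j
        · simp
        · simp [hij]
      · obtain rfl | hij := eq_or_ne i j
        · simpa using insert_subset (mem_union_right (s.F i) hx) subset_union_left
        · simp [hij]
    · refine ⟨fun i y hy => ?_, hs.X_infinite, (hs.mono hqp).X_forced⟩
      obtain rfl | hij := eq_or_ne i j
      · obtain rfl | hy := by simpa using hy
        · exact hqU
        · exact hqp.trans (hs.F_forced i y hy)
      · exact hqp.trans (hs.F_forced i y (by simpa [hij] using hy))
    · exact ⟨x, by simp, hbx⟩
  -- Now `U x j` misses the cylinder for all `x ≥ b` in the reservoir, so the other parts are still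
  -- dense there.
  · refine ⟨p, ⟨s.F, s.X ∩ Ici b, s.J.erase j⟩, Subset.rfl, ?_, ?_, by simp⟩
    · exact ⟨fun _ => Subset.rfl, fun _ => subset_union_left, inter_subset_left,
        Finset.erase_subset _ _⟩
    · refine ⟨hs.F_forced, infinite_inter_Ici hs.X_infinite b, fun x hx g hg => ?_⟩
      refine mem_closure_iff.2 fun V hV hgV => ?_
      obtain ⟨g', ⟨hgV', hgp'⟩, hgU'⟩ :=
        mem_closure_iff.1 (hs.X_forced x hx.1 hg) _ (hV.inter (isOpen_cyl p)) ⟨hgV, hg⟩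
      obtain ⟨i, hi, hgi⟩ := mem_iUnion₂.1 hgU'
      have hij : i ≠ j := by
        rintro rfl
        exact h ⟨x, hx.1, hx.2, g', hgp', hgi⟩
      exact ⟨g', hgV', mem_iUnion₂.2 ⟨i, Finset.mem_erase.2 ⟨hij, hi⟩, hgi⟩⟩

/-- `B` is infinite and all its elements from `b` on have color `v`, where the color of `x` is given
by the values of `g` on the pairs `⟨i, x⟩` with `i < m`. -/
def EventuallyMono {m : ℕ} (g : ℕ → Bool) (B : Set ℕ) (v : Fin m → Bool) (b : ℕ) : Prop :=
  B.Infinite ∧ ∀ x ∈ B, b ≤ x → ∀ i : Fin m, g (Nat.pair i x) = v i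

/-- The cylinder `p` and the state `s` force that the image under `Ψ` of the `j`-th set is not
monochromatic from `b` on with color `v`. -/
def State.Defeats {m : ℕ} (p : (ℕ → Bool) × ℕ) (s : State m) (j : Fin m)
    (Ψ : Set ℕ → Set ℕ) (v : Fin m → Bool) (b : ℕ) : Prop :=
  ∀ H, s.F j ⊆ H → H ⊆ s.F j ∪ s.X → ∀ g ∈ cyl p, ¬ EventuallyMono g (Ψ H) v b

theorem exists_color_avoiding {m : ℕ} (v : Fin m → Fin m → Bool) :
    ∃ l : Fin m → Bool, ∀ j, v j ≠ l := by
  by_contra! h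
  have := Fintype.card_le_of_surjective v h
  simp only [Fintype.card_pi, Fintype.card_bool, Finset.prod_const, Finset.card_univ,
    Fintype.card_fin] at this
  exact absurd this (not_le.2 m.lt_two_pow_self)

/-- Every cylinder can be refined to give a prescribed color to all numbers in a finite interval
that it does not yet restrict. -/
theorem exists_cyl_color {m : ℕ} (p : (ℕ → Bool) × ℕ) (l : Fin m → Bool) (B : ℕ) :
    ∃ q, cyl q ⊆ cyl p ∧ ∀ g ∈ cyl q, ∀ x, p.2 ≤ x → x ≤ B →
      ∀ i : Fin m, g (Nat.pair i x) = l i := by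
  -- A pair `⟨i, x⟩` is at least `x`, so it is free when `p.2 ≤ x`; `Nat.pair m B` bounds all pairs
  -- with `i < m` and `x ≤ B`.
  refine ⟨(fun y => if y < p.2 then p.1 y else
    if h : y.unpair.1 < m then l ⟨y.unpair.1, h⟩ else false, max p.2 (Nat.pair m B + 1)),
    fun g hg y hy => ?_, fun g hg x hpx hxB i => ?_⟩
  · rw [hg y (lt_max_of_lt_left hy)]
    exact if_pos hy
  · have hlt : Nat.pair i x < Nat.pair m B + 1 := by
      refine Nat.lt_succ_of_le ((Nat.pair_lt_pair_left x i.2).le.trans ?_)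
      obtain rfl | hlt := hxB.eq_or_lt
      · exact le_rfl
      · exact (Nat.pair_lt_pair_right m hlt).le
    rw [hg _ (lt_max_of_lt_right hlt)]
    have : ¬ Nat.pair i x < p.2 := not_lt.2 (hpx.trans (Nat.right_le_pair _ _))
    simp [this]

/-- For one of the parts still allowed, a given operator can be prevented from producing a set that
is monochromatic with a given color. -/
theorem State.Valid.exists_extends_defeats {m : ℕ} [NeZero m]
    {U : ℕ → Fin m → Set (ℕ → Bool)} (hU : ∀ x j, IsOpen (U x j)) {p : (ℕ → Bool) × ℕ}
    {s : State m} (hs : s.Valid U p) (Ψ : Fin m → Set ℕ → Set ℕ) (hΨ : ∀ j, FiniteUse (Ψ j))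
    (v : Fin m → Fin m → Bool) (b : Fin m → ℕ) :
    ∃ (q : (ℕ → Bool) × ℕ) (s' : State m), cyl q ⊆ cyl p ∧ s'.Extends s ∧ s'.Valid U q ∧
      ∃ j ∈ s'.J, s'.Defeats q j (Ψ j) (v j) (b j) := by
  classical
  obtain ⟨l, hl⟩ := exists_color_avoiding v
  let W : Fin m → Finset ℕ → Prop := fun j E => ∃ x, p.2 ≤ x ∧ b j ≤ x ∧ x ∈ Ψ j (s.F j ∪ E)
  by_cases h : ∀ j ∈ s.J, ∀ Y ⊆ s.X, Y.Infinite → ∃ E : Finset ℕ, ↑E ⊆ Y ∧ W j E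
  · obtain ⟨M, hM⟩ := exists_bound_of_infinite_subsets hs.X_infinite s.J W h
    have hwit : ∀ (j : Fin m) (E : Finset ℕ), ∃ x, W j E →
        p.2 ≤ x ∧ b j ≤ x ∧ x ∈ Ψ j (s.F j ∪ E) := fun j E => by
      by_cases hW : W j E
      · obtain ⟨x, hx⟩ := hW
        exact ⟨x, fun _ => hx⟩
      · exact ⟨0, fun h => absurd h hW⟩
    choose w hw using hwit
    -- The bound covers the witnesses of every `E` below `M`, since the part `j` and the set `E` are
    -- known only once the partition is decided.
    obtain ⟨q₀, hq₀p, hq₀⟩ := exists_cyl_color p l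
      ((Finset.univ ×ˢ (Finset.range M).powerset).sup fun a => w a.1 a.2)
    obtain ⟨q, hqq₀, hq⟩ := exists_cyl_decide hU s.J q₀ ({x ∈ Finset.range M | x ∈ s.X})
      fun x hx => hq₀p.trans (hs.X_forced x (Finset.mem_filter.1 hx).2)
    have hqp := hqq₀.trans hq₀p
    choose! f hfJ hfU using hq
    obtain ⟨j, hj, E, hE, hWE⟩ := hM f fun x hx hxM =>
      hfJ x (Finset.mem_filter.2 ⟨Finset.mem_range.2 hxM, hx⟩)
    obtain ⟨hpx, hbx, hx⟩ := hw j E hWE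
    have hEM : E ⊆ Finset.range M := fun x hx => Finset.mem_range.2 (hE x hx).2.1
    have hxB := Finset.le_sup (f := fun a : Fin m × Finset ℕ => w a.1 a.2) (b := (j, E))
      (Finset.mem_product.2 ⟨Finset.mem_univ j, Finset.mem_powerset.2 hEM⟩)
    obtain ⟨u, hu⟩ := hΨ j _ _ hx
    -- Cutting the reservoir at the use `u` preserves the computation for every later `H`.
    refine ⟨q, ⟨Function.update s.F j (s.F j ∪ E), s.X ∩ Ici u, s.J⟩, hqp, ?_, ?_, j, hj, ?_⟩
    · refine ⟨fun i => ?_, fun i => ?_, inter_subset_left, Finset.Subset.refl _⟩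
      · obtain rfl | hij := eq_or_ne i j
        · simp
        · simp [hij]
      · obtain rfl | hij := eq_or_ne i j
        · simp only [Function.update_self]
          exact union_subset subset_union_left fun x hx => Or.inr (hE x hx).1
        · simp [hij]
    · refine ⟨fun i y hy => ?_, infinite_inter_Ici hs.X_infinite u,
        fun x hx => hqp.trans (hs.X_forced x hx.1)⟩
      obtain rfl | hij := eq_or_ne i j
      · obtain hy | hy := by simpa using hy
        · exact hqp.trans (hs.F_forced i y hy)
        · obtain ⟨hyX, hyM, hfy⟩ := hE y hy
          exact hfy ▸ hfU y (Finset.mem_filter.2 ⟨Finset.mem_range.2 hyM, hyX⟩)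
      · exact hqp.trans (hs.F_forced i y (by simpa [hij] using hy))
    · intro H hFH hHF g hg hmono
      simp only [Function.update_self] at hFH hHF
      have hxH : w j E ∈ Ψ j H := hu H fun y hy =>
        ⟨fun hyH => (hHF hyH).resolve_right fun hyX => absurd hyX.2 (not_le.2 hy), fun h => hFH h⟩
      refine hl j (funext fun i => ?_)
      rw [← hmono.2 _ hxH hbx i, hq₀ g (hqq₀ hg) _ hpx hxB i]
  · push Not at h
    obtain ⟨j, hj, Y, hYX, hY, hYW⟩ := h
    refine ⟨p, ⟨s.F, Y, s.J⟩, Subset.rfl, ⟨fun _ => Subset.rfl, fun _ => subset_union_left, hYX,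
      Finset.Subset.refl _⟩, ⟨hs.F_forced, hY, fun x hx => hs.X_forced x (hYX hx)⟩, j, hj, ?_⟩
    intro H hFH hHF g _ hmono
    refine hmono.1 ((finite_Iio (max p.2 (b j))).subset fun x hx => ?_)
    by_contra hlt
    simp only [mem_Iio, not_lt, sup_le_iff] at hlt
    obtain ⟨u, hu⟩ := hΨ j _ _ hx
    -- The part of `H` below the use that is new to `F j` would be a finite subset of `Y` with
    -- property `W`.
    refine hYW {y ∈ Finset.range u | y ∈ H ∧ y ∉ s.F j} (fun y hy => ?_)
      ⟨x, hlt.1, hlt.2, hu _ fun y hy => ?_⟩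
    · obtain ⟨-, hyH, hyF⟩ := by simpa using hy
      exact (hHF hyH).resolve_left hyF
    · have := @hFH y
      simp only [mem_union, SetLike.mem_coe, Finset.mem_filter, Finset.mem_range, hy, true_and]
      tauto

/-! ### Forcing for all partitions at once -/

/-- Forcing conditions: a cylinder of sequences of bits together with a valid state for each member
of a family `U` of partitions. -/
structure Cond {ι : Type} {m : ι → ℕ} (U : ∀ t, ℕ → Fin (m t) → Set (ℕ → Bool)) where
  p : (ℕ → Bool) × ℕ
  st : ∀ t, State (m t)
  valid : ∀ t, (st t).Valid (U t) p

namespace Cond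

variable {ι : Type} {m : ι → ℕ} {U : ∀ t, ℕ → Fin (m t) → Set (ℕ → Bool)}

instance : Preorder (Cond U) where
  le c d := cyl d.p ⊆ cyl c.p ∧ ∀ t, (d.st t).Extends (c.st t)
  le_refl c := ⟨Subset.rfl, fun _ => .refl _⟩
  le_trans _ _ _ h h' := ⟨h'.1.trans h.1, fun t => (h'.2 t).trans (h.2 t)⟩

theorem cyl_subset {c d : Cond U} (h : c ≤ d) : cyl d.p ⊆ cyl c.p := h.1

theorem extends_of_le {c d : Cond U} (h : c ≤ d) (t : ι) : (d.st t).Extends (c.st t) := h.2 t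

/-- The condition with no information. -/
def trivial (hU : ∀ t x, Dense (⋃ j, U t x j)) : Cond U where
  p := (fun _ => false, 0)
  st t := ⟨fun _ => ∅, univ, Finset.univ⟩
  valid t := ⟨by simp, infinite_univ, fun x _ => by simp [(hU t x).closure_eq]⟩

theorem exists_update (c : Cond U) (t : ι) {q : (ℕ → Bool) × ℕ} {s : State (m t)}
    (hq : cyl q ⊆ cyl c.p) (hs : s.Extends (c.st t)) (hv : s.Valid (U t) q) :
    ∃ d, c ≤ d ∧ d.p = q ∧ d.st t = s := by
  classical
  refine ⟨⟨q, Function.update c.st t s, fun t' => ?_⟩, ⟨hq, fun t' => ?_⟩, rfl, by simp⟩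
  · obtain rfl | h := eq_or_ne t' t
    · simpa using hv
    · simpa [h] using (c.valid t').mono hq
  · obtain rfl | h := eq_or_ne t' t
    · simpa using hs
    · simpa [h] using State.Extends.refl _

/-- No extension excludes a further part of the partition `t` from the reservoir. -/
def Locked (c : Cond U) (t : ι) : Prop :=
  ∀ d, c ≤ d → (d.st t).J = (c.st t).J

theorem Locked.mono {c d : Cond U} {t : ι} (hc : c.Locked t) (h : c ≤ d) : d.Locked t :=
  fun e he => (hc e (h.trans he)).trans (hc d h).symm

/-- Choose an extension whose finite set `J` has least cardinality. -/
theorem exists_locked (c : Cond U) (t : ι) : ∃ d, c ≤ d ∧ d.Locked t := by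
  obtain ⟨d, hd, hmin⟩ := WellFounded.has_min (measure fun d : Cond U => (d.st t).J.card).wf
    (Ici c) ⟨c, le_refl c⟩
  exact ⟨d, hd, fun e he => Finset.eq_of_subset_of_card_le (extends_of_le he t).J_subset
    (not_lt.1 (hmin e (mem_Ici.2 ((mem_Ici.1 hd).trans he))))⟩

end Cond

/-- A directed set meeting countably many given cofinal sets. -/
theorem exists_ideal_meets {P : Type*} [Preorder P] (p : P) {κ : Type*} [Countable κ]
    (D : κ → Set P) (hD : ∀ k x, ∃ y ∈ D k, x ≤ y) :
    ∃ I : Order.Ideal P, ∀ k, ∃ x ∈ D k, x ∈ I := by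
  have := Encodable.ofCountable κ
  exact ⟨Order.idealOfCofinals p fun k => ⟨D k, hD k⟩, fun k =>
    Order.cofinal_meets_idealOfCofinals p (fun k => ⟨D k, hD k⟩) k⟩

/-- For countably many partitions of the natural numbers that depend continuously on a generic
sequence `g`, and for countably many operators of finite use, every partition has a part with an
infinite subset whose images under all the operators are not eventually monochromatic for `g`. -/
theorem exists_generic {ι : Type} [Countable ι] {m : ι → ℕ} [∀ t, NeZero (m t)]
    {U : ∀ t, ℕ → Fin (m t) → Set (ℕ → Bool)} (hUo : ∀ t x j, IsOpen (U t x j))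
    (hUd : ∀ t x, Dense (⋃ j, U t x j)) {R : Set (ℕ → Bool)} (hR : R ∈ residual (ℕ → Bool))
    {Ψ : ℕ → Set ℕ → Set ℕ} (hΨ : ∀ e, FiniteUse (Ψ e)) :
    ∃ g ∈ R, ∀ t, ∃ j, ∃ H : Set ℕ, H.Infinite ∧ (∀ x ∈ H, g ∈ U t x j) ∧
      ∀ e v b, ¬ EventuallyMono g (Ψ e H) (v : Fin (m t) → Bool) b := by
  obtain ⟨S, hSo, hSd, hSc, hSR⟩ := mem_residual_iff.1 hR
  have : Countable S := hSc
  obtain ⟨I₁, hI⟩ := exists_ideal_meets (Cond.trivial hUd)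
    -- Three kinds of requirements: enter each dense open set, enlarge or exclude each part, and
    -- defeat one entry of each tuple of guesses at a locked condition.
    (κ := S ⊕ (Σ t, Fin (m t) × ℕ) ⊕ (Σ t, Fin (m t) → ℕ × (Fin (m t) → Bool) × ℕ))
    (Sum.elim (fun V => {c | cyl c.p ⊆ V})
      (Sum.elim (fun a => {c | a.2.1 ∈ (c.st a.1).J → ∃ x ∈ (c.st a.1).F a.2.1, a.2.2 ≤ x})
        fun a => {c | c.Locked a.1 ∧ ∃ j ∈ (c.st a.1).J,
          (c.st a.1).Defeats c.p j (Ψ (a.2 j).1) (a.2 j).2.1 (a.2 j).2.2})) (by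
    rintro (V | ⟨t, j, b⟩ | ⟨t, r⟩) c
    · obtain ⟨q, hq, hqV⟩ := exists_cyl_subset (hSo V V.2)
        ((hSd V V.2).inter_open_nonempty _ (isOpen_cyl c.p) ⟨_, self_mem_cyl c.p⟩)
      exact ⟨⟨q, c.st, fun t => (c.valid t).mono hq⟩, hqV, hq, fun t => .refl _⟩
    · obtain ⟨q, s, hq, hs, hv, h⟩ := (c.valid t).exists_extends_large (hUo t) j b
      obtain ⟨d, hcd, rfl, rfl⟩ := c.exists_update t hq hs hv
      exact ⟨d, h, hcd⟩
    · obtain ⟨c', hcc', hlock⟩ := c.exists_locked t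
      obtain ⟨q, s, hq, hs, hv, h⟩ := (c'.valid t).exists_extends_defeats (hUo t)
        (fun j => Ψ (r j).1) (fun j => hΨ _) (fun j => (r j).2.1) (fun j => (r j).2.2)
      obtain ⟨d, hcd, rfl, rfl⟩ := c'.exists_update t hq hs hv
      exact ⟨d, ⟨hlock.mono hcd, h⟩, hcc'.trans hcd⟩)
  have hdir : ∀ c ∈ I₁, ∀ d ∈ I₁, ∃ e ∈ I₁, c ≤ e ∧ d ≤ e := I₁.directed
  obtain ⟨g, hg⟩ : (⋂ c : I₁, cyl c.1.p).Nonempty := by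
    have : Nonempty I₁ := I₁.nonempty.to_subtype
    refine IsCompact.nonempty_iInter_of_directed_nonempty_isCompact_isClosed _ (fun c d => ?_)
      (fun c => ⟨_, self_mem_cyl _⟩) (fun c => (isClosed_cyl _).isCompact)
      fun c => isClosed_cyl _
    obtain ⟨e, he, hce, hde⟩ := hdir c c.2 d d.2
    exact ⟨⟨e, he⟩, Cond.cyl_subset hce, Cond.cyl_subset hde⟩
  replace hg : ∀ c ∈ I₁, g ∈ cyl c.p := fun c hc => mem_iInter.1 hg ⟨c, hc⟩
  refine ⟨g, hSR fun V hV => ?_, fun t => ?_⟩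
  · obtain ⟨c, hcV, hc⟩ := hI (Sum.inl ⟨V, hV⟩)
    exact hcV (hg c hc)
  let H : Fin (m t) → Set ℕ := fun j => {x | ∃ c ∈ I₁, x ∈ (c.st t).F j}
  have hHU : ∀ j, ∀ x ∈ H j, g ∈ U t x j := by
    rintro j x ⟨c, hc, hx⟩
    exact (c.valid t).F_forced j x hx (hg c hc)
  have hFH : ∀ c ∈ I₁, ∀ j, (c.st t).F j ⊆ H j := fun c hc j x hx => ⟨c, hc, hx⟩
  have hHF : ∀ c ∈ I₁, ∀ j, H j ⊆ (c.st t).F j ∪ (c.st t).X := by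
    rintro c hc j x ⟨d, hd, hx⟩
    obtain ⟨e, -, hce, hde⟩ := hdir c hc d hd
    exact (Cond.extends_of_le hce t).F_subset j ((Cond.extends_of_le hde t).subset_F j hx)
  have hinf : ∀ c ∈ I₁, c.Locked t → ∀ j ∈ (c.st t).J, (H j).Infinite := by
    refine fun c hc hlock j hj => infinite_of_forall_exists_gt fun b => ?_
    obtain ⟨d, hd, hdI⟩ := hI (Sum.inr (Sum.inl ⟨t, j, b + 1⟩))
    obtain ⟨e, -, hce, hde⟩ := hdir c hc d hdI
    obtain ⟨x, hx, hbx⟩ := hd ((Cond.extends_of_le hde t).J_subset (hlock e hce ▸ hj))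
    exact ⟨x, ⟨d, hdI, hx⟩, hbx⟩
  by_contra! hcon
  -- One failing guess per part. The default for finite `H j` is harmless: the part defeated lies in
  -- a locked `J`, so its `H j` is infinite.
  have hr : ∀ j, ∃ r : ℕ × (Fin (m t) → Bool) × ℕ,
      (H j).Infinite → EventuallyMono g (Ψ r.1 (H j)) r.2.1 r.2.2 := fun j => by
    by_cases h : (H j).Infinite
    · obtain ⟨e, v, b, h'⟩ := hcon j (H j) h (hHU j)
      exact ⟨(e, v, b), fun _ => h'⟩
    · exact ⟨(0, fun _ => false, 0), fun h' => absurd h' h⟩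
  choose r hr using hr
  obtain ⟨c, ⟨hlock, j, hj, hdef⟩, hc⟩ := hI (Sum.inr (Sum.inr ⟨t, r⟩))
  exact hdef (H j) (hFH c hc j) (hHF c hc j) g (hg c hc) (hr j (hinf c hc hlock j hj))

/-! ### Baire category and the final contradiction -/

theorem FiniteUse.isOpen_setOf_mem {Ψ : Set ℕ → Set ℕ} (hΨ : FiniteUse Ψ) (x : ℕ) :
    IsOpen {g : ℕ → Bool | x ∈ Ψ {y | g y = true}} := by
  refine isOpen_iff_mem_nhds.2 fun g hg => ?_
  obtain ⟨u, hu⟩ := hΨ _ _ hg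
  refine mem_of_superset ((isOpen_cyl (g, u)).mem_nhds (self_mem_cyl (g, u))) fun g' hg' => ?_
  exact hu _ fun y hy => by simp [mem_cyl_iff.1 hg' y hy]

/-- Countably many finite families of Borel sets, of which each family covers the space, can be
replaced by open sets up to a meager set. -/
theorem exists_isOpen_residual {ι : Type} [Countable ι] {m : ι → ℕ}
    {S : ∀ t, ℕ → Fin (m t) → Set (ℕ → Bool)} (hS : ∀ t x j, BaireMeasurableSet (S t x j))
    (hcover : ∀ t x g, ∃ j, g ∈ S t x j) :
    ∃ U : ∀ t, ℕ → Fin (m t) → Set (ℕ → Bool), (∀ t x j, IsOpen (U t x j)) ∧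
      (∀ t x, Dense (⋃ j, U t x j)) ∧
      {g | ∀ t x j, g ∈ S t x j ↔ g ∈ U t x j} ∈ residual (ℕ → Bool) := by
  choose U hUo hU using fun t x j => (hS t x j).residualEq_isOpen
  have hres : {g | ∀ t x j, g ∈ S t x j ↔ g ∈ U t x j} ∈ residual (ℕ → Bool) := by
    refine eventually_countable_forall.2 fun t => eventually_countable_forall.2 fun x =>
      eventually_countable_forall.2 fun j => ?_
    filter_upwards [hU t x j] with g hg
    exact iff_of_eq hg
  refine ⟨U, hUo, fun t x => (dense_of_mem_residual hres).mono fun g hg => ?_, hres⟩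
  obtain ⟨j, hj⟩ := hcover t x g
  exact mem_iUnion.2 ⟨j, (hg t x j).1 hj⟩

/-- A cohesive set is eventually monochromatic for each finite subsequence. -/
theorem IsCohesive.exists_eventuallyMono {R : ℕ → Set ℕ} {T : Set ℕ} (hT : IsCohesive R T)
    {g : ℕ → Bool} (hg : ∀ i x, x ∈ R i ↔ g (Nat.pair i x) = true) (m : ℕ) :
    ∃ (v : Fin m → Bool) (b : ℕ), EventuallyMono g T v b := by
  have hcol : ∀ i : Fin m, ∃ (w : Bool) (b : ℕ), ∀ x ∈ T, b ≤ x → g (Nat.pair i x) = w := by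
    intro i
    obtain h | h := hT.2 i
    · obtain ⟨b, hb⟩ := h.bddAbove
      refine ⟨false, b + 1, fun x hx hbx => ?_⟩
      by_contra hne
      exact absurd (hb ⟨hx, (hg i x).2 (by simpa using hne)⟩) (by lia)
    · obtain ⟨b, hb⟩ := h.bddAbove
      refine ⟨true, b + 1, fun x hx hbx => ?_⟩
      by_contra hne
      exact absurd (hb ⟨hx, fun hxR => hne ((hg i x).1 hxR)⟩) (by lia)
  choose v b hvb using hcol
  exact ⟨v, Finset.univ.sup b, hT.1, fun x hx hbx i =>
    hvb i x hx ((Finset.le_sup (Finset.mem_univ i)).trans hbx)⟩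

/-- The `Σ⁰₂` set of sequences `g` for which the set `P` produced from `g` by the operator `Ψ`
satisfies `∃ a, ∀ b, P n a b`. -/
def sigmaSet (Ψ : Set ℕ → Set ℕ) (n : ℕ) : Set (ℕ → Bool) :=
  {g | ∃ a, ∀ b, Nat.pair n (Nat.pair a b) ∈ Ψ {y | g y = true}}

theorem baireMeasurableSet_sigmaSet {Ψ : Set ℕ → Set ℕ} (hΨ : FiniteUse Ψ) (n : ℕ) :
    BaireMeasurableSet (sigmaSet Ψ n) := by
  have : sigmaSet Ψ n = ⋃ a, ⋂ b, {g : ℕ → Bool |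
      Nat.pair n (Nat.pair a b) ∈ Ψ {y | g y = true}} := by
    ext g
    simp [sigmaSet]
  rw [this]
  exact .iUnion fun a => .iInter fun b => (hΨ.isOpen_setOf_mem _).baireMeasurableSet

theorem not_stronglyReducible_COH_AllD2 : ¬ StronglyReducible COH AllD2 := by
  intro hred
  obtain ⟨Ψ, hΨ, hcomp⟩ := exists_finiteUse_operators
  let m : (Σ k : ℕ, Fin (k + 1) → ℕ) → ℕ := fun t => t.1 + 1
  have hm : ∀ t, NeZero (m t) := fun t => ⟨Nat.succ_ne_zero _⟩
  obtain ⟨U, hUo, hUd, hres⟩ := exists_isOpen_residual (m := m)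
    -- Adding the complement of the union makes the family cover every `g`, even where the codes
    -- `t.2` define no partition.
    (S := fun t x j => sigmaSet (Ψ (t.2 j)) x ∪ (⋃ i, sigmaSet (Ψ (t.2 i)) x)ᶜ)
    (fun t x j => (baireMeasurableSet_sigmaSet (hΨ _) x).union
      (BaireMeasurableSet.iUnion fun i => baireMeasurableSet_sigmaSet (hΨ _) x).compl)
    (fun t x g => by
      by_cases h : g ∈ ⋃ i, sigmaSet (Ψ (t.2 i)) x
      · obtain ⟨j, hj⟩ := mem_iUnion.1 h
        exact ⟨j, Or.inl hj⟩
      · exact ⟨0, Or.inr h⟩)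
  obtain ⟨g, hgres, hg⟩ := exists_generic hUo hUd hres hΨ
  have hjoin : seqJoin (fun i => {x | g (Nat.pair i x) = true}) = {y | g y = true} := by
    ext y
    simp [seqJoin]
  obtain ⟨⟨k, B⟩, hB, hsol⟩ := hred fun i => {x | g (Nat.pair i x) = true}
  replace hB : Computes {y | g y = true} B.X := hjoin ▸ hB
  -- No partition of `ℕ` has zero parts.
  obtain _ | k := k
  · have h0 : (0 : ℕ) ∈ ⋃ j, B.A j := B.cover ▸ mem_univ 0
    obtain ⟨j, -⟩ := mem_iUnion.1 h0
    exact j.elim0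
  have hcode : ∀ j, ∃ e, ∀ x, x ∈ B.A j ↔ g ∈ sigmaSet (Ψ e) x := fun j => by
    obtain ⟨P, hP, hA⟩ := (B.delta j).1
    obtain ⟨e, rfl⟩ := hcomp _ _ (TuringReducible.trans hP hB)
    exact ⟨e, hA⟩
  choose e he using hcode
  obtain ⟨j, H, hH, hHU, hmono⟩ := hg ⟨k, e⟩
  have hHA : H ⊆ B.A j := fun x hx => by
    obtain h | h := (hgres ⟨k, e⟩ x j).2 (hHU x hx)
    · exact (he j x).2 h
    · have hx' : x ∈ ⋃ i, B.A i := B.cover ▸ mem_univ x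
      obtain ⟨i, hi⟩ := mem_iUnion.1 hx'
      exact absurd (mem_iUnion.2 ⟨i, (he i x).1 hi⟩) h
  obtain ⟨T, hT, hHT⟩ := hsol H ⟨hH, j, hHA⟩
  obtain ⟨d, rfl⟩ := hcomp _ _ hHT
  obtain ⟨v, b, hvb⟩ := IsCohesive.exists_eventuallyMono hT (g := g) (fun _ _ => Iff.rfl) (k + 1)
  exact hmono d v b hvb

theorem StronglyReducible.allD2_of_D2 {P : Principle} {m : ℕ} (h : StronglyReducible P (D2 m)) :
    StronglyReducible P AllD2 := fun A =>
  let ⟨B, hB, hsol⟩ := h A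
  ⟨⟨m, B⟩, hB, hsol⟩

end CohesiveAvoidance

theorem mainTheorem3 :
    (∀ m : ℕ, ¬ CohesiveAvoidance.StronglyReducible
      CohesiveAvoidance.COH (CohesiveAvoidance.D2 m)) ∧
    ¬ CohesiveAvoidance.StronglyReducible
      CohesiveAvoidance.COH CohesiveAvoidance.AllD2 :=
  ⟨fun _ h => CohesiveAvoidance.not_stronglyReducible_COH_AllD2 h.allD2_of_D2,
    CohesiveAvoidance.not_stronglyReducible_COH_AllD2⟩
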